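/- Let $M$ be a smooth (finite-dimensional, Hausdorff) manifold. Write $A^k(M)=\Gamma(\wedge^kTM)$ for the smooth $k$-vector fields ($A^0(M)=C^\infty(M)$, $A^k(M)=0$ for $k<0$), $\mathcal A(M)=\bigoplus_k A^k(M)$, $\Omega^m(M)$ for the $m$-forms, and $[\cdot,\cdot]$ for the Schouten–Nijenhuis bracket: the $\mathbb R$-bilinear extension of the Lie bracket of vector fields such that $[f,g]=0$ and $[X,Q]=L_XQ$ for functions $f,g$, vector fields $X$ and $Q\in\mathcal A(M)$, $[P,Q]=-(-1)^{(p-1)(q-1)}[Q,P]$, and $[P,\cdot]$ is a derivation of degree $p-1$ of the exterior product, for $P\in A^p(M)$, $Q\in A^q(M)$. For $X\in A^k(M)$ and a form $\omega$ let $i_X\omega=\omega(X\wedge\,\cdot\,)$ (with $i_f\omega=f\omega$ for functions $f$, and $i_X\omega=0$ if $\deg\omega<k$) and $L_X\omega=d\,i_X\omega-(-1)^k i_X\,d\omega$. A higher connection on $M$ is a map $\nabla:\mathcal A(M)\times\mathcal A(M)\to\mathcal A(M)$, additive in both arguments, with $\nabla_XY\in A^{k+l-1}(M)$ for $X\in A^k(M)$,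 $Y\in A^l(M)$; $\nabla_{fX}Y=f\nabla_XY$; $\nabla_Xf=[X,f]$; $\nabla_X(fY)=[X,f]\wedge Y+f\nabla_XY$; $\nabla_fX=0$ (for $f\in C^\infty(M)$). It is induced if, for all $X\in A^k(M)$, $Y\in A^l(M)$, $Z\in\mathcal A(M)$, $$\nabla_{X\wedge Y}Z=X\wedge\nabla_YZ+(-1)^{kl}\,Y\wedge\nabla_XZ,\qquad \nabla_X(Y\wedge Z)=(\nabla_XY)\wedge Z+(-1)^{(k-1)l}\,Y\wedge\nabla_XZ,$$ and torsion-free if $\nabla_XY-(-1)^{(k-1)(l-1)}\nabla_YX-[X,Y]=0$ for all $X\in A^k(M)$, $Y\in A^l(M)$. For $\omega\in\Omega^m(M)$ and $X\in A^k(M)$ with $k>0$ and $m-k+1\ge0$, the covariant derivative $\nabla_X\omega$ is the form of degree $m-k+1$ with $$(\nabla_X\omega)(Y)=(-1)^{(k-1)(m-1)}L_X\,i_Y\omega-\omega(\nabla_XY)\qquad\text{for all }Y\in A^{m-k+1}(M),$$ where $\eta(f)=f\eta$ for functions $\eta,f$; and $\nabla_X\omega=0$ if $k=0$ or $m-k+1<0$.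 Theorem. Let $\nabla$ be a torsion-free induced higher connection on $M$. Then the covariant derivatives $\nabla_X\omega$ are well defined by these conditions, and $$\nabla_{X\wedge Y}\,\omega=(-1)^l\,i_Y\nabla_X\omega+(-1)^{k(l-1)}\,i_X\nabla_Y\omega$$ for all $k,l,m\ge0$, $X\in A^k(M)$, $Y\in A^l(M)$ and $\omega\in\Omega^m(M)$. -/

import Mathlib

open scoped Manifold ContDiff

noncomputable section

namespace HigherConn

/-! ## Multivectors and forms on the model space -/

/-- The model space `ℝⁿ`. -/
abbrev Model (n : ℕ) : Type := EuclideanSpace ℝ (Fin n)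

/-- The basis `e_S = e_{i₁} ∧ ⋯ ∧ e_{i_k}`, `S = {i₁ < ⋯ < i_k}`, of the exterior algebra of `ℝⁿ`. -/
def extBasis (n : ℕ) : Module.Basis (Finset (Fin n)) ℝ (ExteriorAlgebra ℝ (Model n)) :=
  (EuclideanSpace.basisFun (Fin n) ℝ).toBasis.ExteriorAlgebra

/-- The partial derivative `∂_i g` at `y` of a function with values in the exterior algebra of
`ℝⁿ`, computed component by component in the basis `e_S`. -/
def partialDeriv {n : ℕ} (i : Fin n) (g : Model n → ExteriorAlgebra ℝ (Model n)) (y : Model n) :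
    ExteriorAlgebra ℝ (Model n) :=
  ∑ S : Finset (Fin n),
    (fderiv ℝ (fun z => (extBasis n).repr (g z) S) y (EuclideanSpace.single i 1)) • extBasis n S

/-- The contraction `dx^i ⌋ v` of a multivector: the antiderivation with
`dx^i ⌋ (v₁ ∧ ⋯ ∧ v_k) = ∑ⱼ (-1)^(j-1) dx^i(vⱼ) v₁ ∧ ⋯ ∧ v̂ⱼ ∧ ⋯ ∧ v_k`. -/
def contractDx {n : ℕ} (i : Fin n) :
    ExteriorAlgebra ℝ (Model n) →ₗ[ℝ] ExteriorAlgebra ℝ (Model n) :=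
  CliffordAlgebra.contractLeft
    (EuclideanSpace.proj i : Model n →L[ℝ] ℝ).toLinearMap

/-- The Schouten–Nijenhuis bracket in coordinates. For `p` of degree `k` this is
`[p, q] = (-1)^(k-1) ∑ᵢ (dx^i ⌋ p) ∧ ∂_i q - ∑ᵢ ∂_i p ∧ (dx^i ⌋ q)`
(`involute` multiplies a multivector of degree `k - 1` by `(-1)^(k-1)`). -/
def schoutenCoord {n : ℕ} (p q : Model n → ExteriorAlgebra ℝ (Model n)) (y : Model n) :
    ExteriorAlgebra ℝ (Model n) :=
  ∑ i : Fin n, (CliffordAlgebra.involute (contractDx i (p y)) * partialDeriv i q y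
    - partialDeriv i p y * contractDx i (q y))

theorem continuous_alternatingMap {n j : ℕ} (f : Model n [⋀^Fin j]→ₗ[ℝ] ℝ) : Continuous f := by
  have h : ∀ v : Fin j → Model n,
      f v = ∑ r : Fin j → Fin n, (∏ i, v i (r i)) •
        f (fun i => (EuclideanSpace.basisFun (Fin n) ℝ).toBasis (r i)) := by
    intro v
    have hv : v = fun i => ∑ s, v i s • (EuclideanSpace.basisFun (Fin n) ℝ).toBasis s := by
      funext i
      conv_lhs => rw [← (EuclideanSpace.basisFun (Fin n) ℝ).toBasis.sum_repr (v i)]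
      simp
    conv_lhs => rw [hv]
    have h1 := f.toMultilinearMap.map_sum
      (fun i s => v i s • (EuclideanSpace.basisFun (Fin n) ℝ).toBasis s)
    have h2 : ∀ r : Fin j → Fin n, f (fun i => v i (r i) •
        (EuclideanSpace.basisFun (Fin n) ℝ).toBasis (r i)) = (∏ i, v i (r i)) •
        f (fun i => (EuclideanSpace.basisFun (Fin n) ℝ).toBasis (r i)) :=
      fun r => f.toMultilinearMap.map_smul_univ _ _
    simp only [← h2]
    exact h1
  have h' : (f : (Fin j → Model n) → ℝ) = _ := funext h
  rw [h']
  fun_prop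

/-- An alternating form on `ℝⁿ`, as a continuous one. -/
def toContinuousAlternating {n j : ℕ} (f : Model n [⋀^Fin j]→ₗ[ℝ] ℝ) :
    Model n [⋀^Fin j]→L[ℝ] ℝ :=
  { f with cont := continuous_alternatingMap f }

/-- The exterior derivative on `ℝⁿ`. A differential form is given as a function with values in the
linear functionals on the exterior algebra; its component of degree `j` is the alternating form
`(v₁, …, vⱼ) ↦ w(v₁ ∧ ⋯ ∧ vⱼ)`. -/
def extDerivCoord {n : ℕ} (w : Model n → Module.Dual ℝ (ExteriorAlgebra ℝ (Model n)))
    (y : Model n) : Module.Dual ℝ (ExteriorAlgebra ℝ (Model n)) :=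
  ExteriorAlgebra.liftAlternating (R := ℝ) fun j =>
    match j with
    | 0 => 0
    | j + 1 => (extDeriv (fun z => toContinuousAlternating
        ((w z).compAlternatingMap (ExteriorAlgebra.ιMulti ℝ j))) y).toAlternatingMap

/-! ## Multivector fields and differential forms on a manifold -/

section Manifold

variable {n : ℕ} {M : Type*} [TopologicalSpace M] [ChartedSpace (Model n) M]
  [IsManifold (𝓡 n) ∞ M]

variable (n M) in
/-- Arbitrary sections of the full exterior bundle `⋀ TM`. -/
abbrev MVSection : Type _ := (x : M) → ExteriorAlgebra ℝ (TangentSpace (𝓡 n) x)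

variable (n M) in
/-- Arbitrary sections of the dual bundle `(⋀ TM)* = ⨁ₘ (⋀ᵐ TM)*`. A linear functional on `⋀ᵐ V` is
the same as an alternating `m`-linear form on `V`, so an `m`-form on `M` is a section vanishing
on `⋀ʲ TM` for `j ≠ m`. -/
abbrev FormSection : Type _ :=
  (x : M) → Module.Dual ℝ (ExteriorAlgebra ℝ (TangentSpace (𝓡 n) x))

/-- For `p` in the domain of the chart at `x`: the map `⋀ T_pM → ⋀ ℝⁿ` induced by the derivative at
`p` of the chart at `x`. -/
def toChart (x p : M) :
    ExteriorAlgebra ℝ (TangentSpace (𝓡 n) p) →ₐ[ℝ] ExteriorAlgebra ℝ (Model n) :=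
  ExteriorAlgebra.map
    ((trivializationAt (Model n) (TangentSpace (𝓡 n)) x).continuousLinearMapAt ℝ p).toLinearMap

/-- For `p` in the domain of the chart at `x`: the inverse `⋀ ℝⁿ → ⋀ T_pM` of `toChart x p`. -/
def fromChart (x p : M) :
    ExteriorAlgebra ℝ (Model n) →ₐ[ℝ] ExteriorAlgebra ℝ (TangentSpace (𝓡 n) p) :=
  ExteriorAlgebra.map
    ((trivializationAt (Model n) (TangentSpace (𝓡 n)) x).symmL ℝ p).toLinearMap

/-- A section of `⋀ TM` is smooth if its components in the charts are. -/
def IsSmoothMV (X : MVSection n M) : Prop :=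
  ∀ (x : M) (S : Finset (Fin n)),
    ContMDiffAt (𝓡 n) 𝓘(ℝ, ℝ) ∞ (fun p => (extBasis n).repr (toChart x p (X p)) S) x

/-- A section of `(⋀ TM)*` is smooth if its components in the charts are. -/
def IsSmoothForm (w : FormSection n M) : Prop :=
  ∀ (x : M) (S : Finset (Fin n)),
    ContMDiffAt (𝓡 n) 𝓘(ℝ, ℝ) ∞ (fun p => w p (fromChart x p (extBasis n S))) x

variable (n M) in
/-- The algebra `𝒜(M)` of multivector fields: smooth sections of `⋀ TM`, with the pointwise exterior
product as multiplication. -/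
def MVField : Subalgebra ℝ (MVSection n M) where
  carrier := {X | IsSmoothMV X}
  mul_mem' := by
    intro X Y hX hY x S
    have h : (fun p => (extBasis n).repr (toChart x p ((X * Y) p)) S) = fun p =>
        ∑ A, ∑ B, (extBasis n).repr (toChart x p (X p)) A *
          ((extBasis n).repr (toChart x p (Y p)) B *
            (extBasis n).repr (extBasis n A * extBasis n B) S) := by
      funext p
      rw [Pi.mul_apply, map_mul]
      conv_lhs => rw [← (extBasis n).sum_repr (toChart x p (X p)),
        ← (extBasis n).sum_repr (toChart x p (Y p))]
      simp only [Finset.sum_mul_sum, map_sum, Finsupp.coe_finsetSum, Finset.sum_apply,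
        smul_mul_smul_comm, map_smul, Finsupp.smul_apply, smul_eq_mul, mul_assoc]
    rw [h]
    exact contMDiffAt_finsetSum fun A _ => contMDiffAt_finsetSum fun B _ =>
      (hX x A).mul ((hY x B).mul contMDiffAt_const)
  add_mem' := by
    intro X Y hX hY x S
    have h := (hX x S).add (hY x S)
    refine h.congr_of_eventuallyEq (Filter.Eventually.of_forall fun p => ?_)
    simp
  algebraMap_mem' := by
    intro r x S
    simpa using contMDiffAt_const

/-- `A^k(M)`: the multivector fields of degree `k`, i.e. the sections of `⋀ᵏ TM`. -/
def IsDegree (k : ℕ) (X : MVField n M) : Prop :=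
  ∀ x : M, X.1 x ∈ ⋀[ℝ]^k (TangentSpace (𝓡 n) x)

/-- Smooth functions, as multivector fields of degree `0`. -/
def ofFun (f : C^∞⟮𝓡 n, M; 𝓘(ℝ, ℝ), ℝ⟯) : MVField n M :=
  ⟨fun x => algebraMap ℝ _ (f x), by
    intro x S
    have h : (fun p => (extBasis n).repr (toChart x p
        (algebraMap ℝ (ExteriorAlgebra ℝ (TangentSpace (𝓡 n) p)) (f p))) S) =
        fun p => f p * (extBasis n).repr 1 S := by
      funext p
      rw [AlgHom.commutes, Algebra.algebraMap_eq_smul_one, map_smul, Finsupp.smul_apply,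
        smul_eq_mul]
    rw [h]
    exact f.contMDiff.contMDiffAt.mul contMDiffAt_const⟩

/-- `w` is a differential `m`-form: a smooth section of `(⋀ᵐ TM)*`. -/
structure IsForm (m : ℕ) (w : FormSection n M) : Prop where
  smooth : IsSmoothForm w
  degree : ∀ (x : M) (j : ℕ), j ≠ m → ∀ v ∈ ⋀[ℝ]^j (TangentSpace (𝓡 n) x), w x v = 0

/-- The Schouten–Nijenhuis bracket, computed at `x` in the chart at `x`. -/
def schouten (X Y : MVSection n M) : MVSection n M := fun x =>
  fromChart x x (schoutenCoord
    (fun y => toChart x ((extChartAt (𝓡 n) x).symm y) (X ((extChartAt (𝓡 n) x).symm y)))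
    (fun y => toChart x ((extChartAt (𝓡 n) x).symm y) (Y ((extChartAt (𝓡 n) x).symm y)))
    (extChartAt (𝓡 n) x x))

/-- The exterior derivative, computed at `x` in the chart at `x`. -/
def extD (w : FormSection n M) : FormSection n M := fun x =>
  extDerivCoord
    (fun y => (w ((extChartAt (𝓡 n) x).symm y)) ∘ₗ
      (fromChart x ((extChartAt (𝓡 n) x).symm y)).toLinearMap)
    (extChartAt (𝓡 n) x x) ∘ₗ (toChart x x).toLinearMap

/-- The interior product `(i_X w)(Z) = w(X ∧ Z)`. For `X` of degree `k` and an `m`-form `w` this is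
the function `w(X)` if `k = m` and `0` if `k > m`; for a function `f` it is `f w`. -/
def interiorProd (X : MVSection n M) (w : FormSection n M) : FormSection n M := fun x =>
  w x ∘ₗ LinearMap.mulLeft ℝ (X x)

/-- The Lie derivative `L_X w = d i_X w - (-1)^k i_X d w` along a multivector field of degree `k`. -/
def lieDeriv (k : ℕ) (X : MVSection n M) (w : FormSection n M) : FormSection n M :=
  extD (interiorProd X w) - (-1 : ℝ) ^ k • interiorProd X (extD w)

variable (n M) in
/-- Higher affine connections `(X, Y) ↦ ∇_X Y` on `M`. -/
structure HigherConnection where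
  cov : MVField n M → MVField n M → MVField n M
  /-- `∇_X Y ∈ A^(k+l-1)(M)` for `X ∈ A^k(M)`, `Y ∈ A^l(M)`. (For `k = l = 0`, where
  `A^(-1)(M) = 0`, this is contained in `cov_fun`.) -/
  degree : ∀ (k l j : ℕ) (X Y : MVField n M), IsDegree k X → IsDegree l Y → j + 1 = k + l →
    IsDegree j (cov X Y)
  left_linear : ∀ (f : C^∞⟮𝓡 n, M; 𝓘(ℝ, ℝ), ℝ⟯) (X X' Y : MVField n M),
    cov (ofFun f * X + X') Y = ofFun f * cov X Y + cov X' Y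
  right_add : ∀ X Y Y' : MVField n M, cov X (Y + Y') = cov X Y + cov X Y'
  apply_fun : ∀ (k : ℕ) (X : MVField n M) (f : C^∞⟮𝓡 n, M; 𝓘(ℝ, ℝ), ℝ⟯), IsDegree k X →
    (cov X (ofFun f)).1 = schouten X.1 (ofFun f).1
  leibniz : ∀ (k : ℕ) (X : MVField n M) (f : C^∞⟮𝓡 n, M; 𝓘(ℝ, ℝ), ℝ⟯) (Y : MVField n M),
    IsDegree k X →
    (cov X (ofFun f * Y)).1 = schouten X.1 (ofFun f).1 * Y.1 + (ofFun f * cov X Y).1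
  cov_fun : ∀ (f : C^∞⟮𝓡 n, M; 𝓘(ℝ, ℝ), ℝ⟯) (X : MVField n M), cov (ofFun f) X = 0

namespace HigherConnection

/-- `∇` is induced:
`∇_{X∧Y} Z = X ∧ ∇_Y Z + (-1)^(kl) Y ∧ ∇_X Z` and
`∇_X (Y∧Z) = (∇_X Y) ∧ Z + (-1)^((k-1)l) Y ∧ ∇_X Z`. -/
structure IsInduced (D : HigherConnection n M) : Prop where
  lower : ∀ (k l : ℕ) (X Y Z : MVField n M), IsDegree k X → IsDegree l Y →
    D.cov (X * Y) Z = X * D.cov Y Z + (-1 : ℝ) ^ (k * l) • (Y * D.cov X Z)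
  upper : ∀ (k l : ℕ) (X Y Z : MVField n M), IsDegree k X → IsDegree l Y →
    D.cov X (Y * Z) =
      D.cov X Y * Z + (-1 : ℝ) ^ (((k : ℤ) - 1) * (l : ℤ)) • (Y * D.cov X Z)

/-- The higher torsion `T(X,Y) = ∇_X Y - (-1)^((k-1)(l-1)) ∇_Y X - [X,Y]` of `X ∈ A^k(M)`,
`Y ∈ A^l(M)`. -/
def torsion (D : HigherConnection n M) (k l : ℕ) (X Y : MVField n M) : MVSection n M :=
  (D.cov X Y).1 - (-1 : ℝ) ^ (((k : ℤ) - 1) * ((l : ℤ) - 1)) • (D.cov Y X).1 - schouten X.1 Y.1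

/-- `∇` is torsion-free. -/
def IsTorsionFree (D : HigherConnection n M) : Prop :=
  ∀ (k l : ℕ) (X Y : MVField n M), IsDegree k X → IsDegree l Y → D.torsion k l X Y = 0

/-- `h` is the covariant derivative `∇_X w` of the `m`-form `w` along `X ∈ A^k(M)`: the form of
degree `m - k + 1` with `h(Y) = (-1)^((k-1)(m-1)) L_X i_Y w - w(∇_X Y)` for all
`Y ∈ A^(m-k+1)(M)` if `k > 0`, and `0` if `k = 0` (or `m - k + 1 < 0`).
These conditions determine `h` pointwise, since every multivector is the value of a multivector
field; in particular the smoothness of `h` is automatic and need not be required.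
Here `L_X i_Y w` is a form of degree `0`, i.e. the function `x ↦ (L_X i_Y w)_x(1)`. -/
structure IsCovDeriv (D : HigherConnection n M) (k m : ℕ) (X : MVField n M)
    (w h : FormSection n M) : Prop where
  degree : ∀ (x : M) (j : ℕ), j + k ≠ m + 1 →
    ∀ v ∈ ⋀[ℝ]^j (TangentSpace (𝓡 n) x), h x v = 0
  apply : 0 < k → ∀ (j : ℕ) (Y : MVField n M), j + k = m + 1 → IsDegree j Y → ∀ x : M,
    h x (Y.1 x) = (-1 : ℝ) ^ (((k : ℤ) - 1) * ((m : ℤ) - 1)) *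
      lieDeriv k X.1 (interiorProd Y.1 w) x 1 - w x ((D.cov X Y).1 x)
  zero : k = 0 → h = 0

open Classical in
/-- The covariant derivative `∇_X w` of an `m`-form `w` along `X ∈ A^k(M)`. -/
def covForm (D : HigherConnection n M) (k m : ℕ) (X : MVField n M) (w : FormSection n M) :
    FormSection n M :=
  if h : ∃ η, D.IsCovDeriv k m X w η then h.choose else 0

end HigherConnection

end Manifold

end HigherConn

end

open HigherConn

/-!
In coordinates `dω = ∑ᵢ ∂_i ω(dxⁱ ⌋ ·)`, and `dxⁱ ⌋` is an antiderivation, so for `X` and `Y` of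
degrees `k` and `l` the value `dω(X ∧ Y)` expands into Cartan's formula
`dω(X ∧ Y) = (-1)^((k-1)l) d(i_Y ω)(X) + (-1)^k d(i_X ω)(Y) + (-1)^k ω([X, Y])`:
the terms with derivatives of `X` and `Y` form the Schouten bracket.

For a function in place of `Y` the formula shows that
`Y ↦ (-1)^((k-1)(m-1)) L_X i_Y ω - ω(∇_X Y)` is linear over `C^∞(M)` on the fields of degree
`m - k + 1`. Its value at `x` then depends only on `Y x`, as one sees by cutting off the components
of `Y` in a chart, so it is the value of a form.

For `i_Z ω` in place of `ω` the formula expresses `d(i_Z ω)(X ∧ Y)` by `d(i_{Y ∧ Z} ω)(X)`,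
`d(i_{X ∧ Z} ω)(Y)` and `ω([X, Y] ∧ Z)`. The axioms of a torsion-free induced connection express
`∇_{X ∧ Y} Z` by `∇_X (Y ∧ Z)`, `∇_Y (X ∧ Z)` and `[X, Y] ∧ Z` with the same signs, so that the
brackets cancel in the difference.

Exponents `k - 1` of `-1` are written `k + 1`, which avoids subtraction of natural numbers.
-/

noncomputable section

namespace HigherConn

section ExteriorAlgebra

open ExteriorAlgebra CliffordAlgebra

variable {R V W : Type*} [CommRing R] [AddCommGroup V] [Module R V] [AddCommGroup W] [Module R W]

theorem ι_mul_eq_involute_mul_ι (v : V) (a : ExteriorAlgebra R V) :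
    ExteriorAlgebra.ι R v * a = involute a * ExteriorAlgebra.ι R v := by
  induction a using CliffordAlgebra.left_induction with
  | algebraMap r => rw [AlgHom.commutes, Algebra.commutes]
  | add a b ha hb => rw [mul_add, map_add, add_mul, ha, hb]
  | ι_mul a u ha =>
    have hswap : ExteriorAlgebra.ι R v * ExteriorAlgebra.ι R u =
        -(ExteriorAlgebra.ι R u * ExteriorAlgebra.ι R v) :=
      eq_neg_of_add_eq_zero_left (ι_add_mul_swap v u)
    rw [map_mul, involute_ι, ← mul_assoc]
    change ExteriorAlgebra.ι R v * ExteriorAlgebra.ι R u * a = _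
    rw [hswap, neg_mul, mul_assoc, ha, neg_mul, neg_mul, mul_assoc]

theorem contractLeft_mul (d : Module.Dual R V) (a b : ExteriorAlgebra R V) :
    contractLeft d (a * b) = contractLeft d a * b + involute a * contractLeft d b := by
  induction a using CliffordAlgebra.left_induction generalizing b with
  | algebraMap r =>
    rw [contractLeft_algebraMap_mul, contractLeft_algebraMap, AlgHom.commutes, zero_mul, zero_add]
  | add a a' ha ha' => simp only [add_mul, map_add, ha, ha']; abel
  | ι_mul a v ha =>
    rw [mul_assoc, contractLeft_ι_mul, ha, contractLeft_ι_mul, map_mul, involute_ι]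
    simp only [mul_add, sub_mul, smul_mul_assoc, mul_assoc, neg_mul]
    abel

theorem involute_contractLeft (d : Module.Dual R V) (a : ExteriorAlgebra R V) :
    involute (contractLeft d a) = -contractLeft d (involute a) := by
  induction a using CliffordAlgebra.left_induction with
  | algebraMap r => simp only [AlgHom.commutes, contractLeft_algebraMap, map_zero, neg_zero]
  | add a b ha hb => simp only [map_add, ha, hb, neg_add]
  | ι_mul a v ha =>
    simp only [contractLeft_ι_mul, map_sub, map_smul, map_mul, involute_ι, ha, neg_mul, mul_neg,
      map_neg]
    abel

theorem involute_map (f : V →ₗ[R] W) (a : ExteriorAlgebra R V) :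
    involute (ExteriorAlgebra.map f a) = ExteriorAlgebra.map f (involute a) := by
  have h : involute.comp (ExteriorAlgebra.map f) = (ExteriorAlgebra.map f).comp involute :=
    ExteriorAlgebra.hom_ext (LinearMap.ext fun v => by
      simp [ExteriorAlgebra.ι, ExteriorAlgebra.map])
  exact DFunLike.congr_fun h a

theorem contractLeft_ιMulti (d : Module.Dual R V) {k : ℕ} (v : Fin (k + 1) → V) :
    contractLeft d (ιMulti R (k + 1) v) =
      ∑ j : Fin (k + 1), ((-1) ^ (j : ℕ) * d (v j)) • ιMulti R k (j.removeNth v) := by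
  induction k with
  | zero =>
    rw [ιMulti_succ_apply, ExteriorAlgebra.ι, contractLeft_ι_mul]
    simp [contractLeft_one]
  | succ k ih =>
    rw [ιMulti_succ_apply, ExteriorAlgebra.ι, contractLeft_ι_mul, Fin.sum_univ_succ, ih,
      Finset.mul_sum, sub_eq_add_neg, ← Finset.sum_neg_distrib]
    congr 1
    · simp [Fin.removeNth_zero, Matrix.vecTail, Fin.tail_def]
      rfl
    · refine Finset.sum_congr rfl fun j _ => ?_
      have hremove : j.succ.removeNth v = Fin.cons (v 0) (j.removeNth (Matrix.vecTail v)) := by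
        funext i
        cases i using Fin.cases <;> simp [Fin.removeNth, Matrix.vecTail]
      rw [hremove, ιMulti_succ_apply, mul_smul_comm, ← neg_smul, Fin.val_succ, pow_succ]
      simp [Matrix.vecTail]

theorem map_mem_exteriorPower (f : V →ₗ[R] W) {k : ℕ} {a : ExteriorAlgebra R V}
    (ha : a ∈ ⋀[R]^k V) : ExteriorAlgebra.map f a ∈ ⋀[R]^k W := by
  have hι : (LinearMap.range (ExteriorAlgebra.ι R)).map (ExteriorAlgebra.map f).toLinearMap ≤
      LinearMap.range (ExteriorAlgebra.ι R (M := W)) := by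
    rw [← LinearMap.range_comp]
    rintro _ ⟨v, rfl⟩
    exact ⟨f v, (map_apply_ι f v).symm⟩
  have h := Submodule.mem_map_of_mem (f := (ExteriorAlgebra.map f).toLinearMap) ha
  rw [Submodule.map_pow] at h
  exact pow_le_pow_left' hι k h

variable (R V) in
/-- The multivectors of the same parity as `k`: those on which the grade involution acts as
`(-1)^k`. Signs are counted with the parity rather than the degree because contracting lowers the
degree `k` to `k - 1`, but always changes the parity from `k` to `k + 1`, also for `k = 0`. -/
def paritySubmodule (k : ℕ) : Submodule R (ExteriorAlgebra R V) :=
  LinearMap.eqLocus (involute (Q := (0 : QuadraticForm R V))).toLinearMap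
    ((-1 : R) ^ k • LinearMap.id)

theorem mem_paritySubmodule {k : ℕ} {a : ExteriorAlgebra R V} :
    a ∈ paritySubmodule R V k ↔ involute a = (-1 : R) ^ k • a :=
  Iff.rfl

theorem mul_mem_paritySubmodule {k l : ℕ} {a b : ExteriorAlgebra R V}
    (ha : a ∈ paritySubmodule R V k) (hb : b ∈ paritySubmodule R V l) :
    a * b ∈ paritySubmodule R V (k + l) := by
  rw [mem_paritySubmodule] at *
  rw [map_mul, ha, hb, smul_mul_smul_comm, pow_add]

theorem contractLeft_mem_paritySubmodule (d : Module.Dual R V) {k : ℕ} {a : ExteriorAlgebra R V}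
    (ha : a ∈ paritySubmodule R V k) : contractLeft d a ∈ paritySubmodule R V (k + 1) := by
  rw [mem_paritySubmodule] at *
  rw [involute_contractLeft, ha, map_smul, pow_succ, mul_neg_one, neg_smul]

theorem involute_mem_paritySubmodule {k : ℕ} {a : ExteriorAlgebra R V}
    (ha : a ∈ paritySubmodule R V k) : involute a ∈ paritySubmodule R V k := by
  rw [mem_paritySubmodule.1 ha]
  exact Submodule.smul_mem _ _ ha

theorem map_mem_paritySubmodule (f : V →ₗ[R] W) {k : ℕ} {a : ExteriorAlgebra R V}
    (ha : a ∈ paritySubmodule R V k) : ExteriorAlgebra.map f a ∈ paritySubmodule R W k := by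
  rw [mem_paritySubmodule] at *
  rw [involute_map, ha, map_smul]

theorem exteriorPower_le_paritySubmodule (k : ℕ) : ⋀[R]^k V ≤ paritySubmodule R V k := by
  induction k with
  | zero =>
    rw [exteriorPower, pow_zero, Submodule.one_le]
    exact mem_paritySubmodule.2 (by simp)
  | succ k ih =>
    rw [exteriorPower, pow_succ]
    refine Submodule.mul_le.2 fun a ha _ hv => mul_mem_paritySubmodule (ih ha) ?_
    obtain ⟨v, rfl⟩ := hv
    exact mem_paritySubmodule.2 (by simp [ExteriorAlgebra.ι])

theorem mul_comm_of_mem_exteriorPower_left {k l : ℕ} {a b : ExteriorAlgebra R V}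
    (ha : a ∈ ⋀[R]^k V) (hb : b ∈ paritySubmodule R V l) :
    a * b = (-1 : R) ^ (k * l) • (b * a) := by
  induction ha using Submodule.pow_induction_on_left' with
  | algebraMap r => rw [zero_mul, pow_zero, one_smul, Algebra.commutes]
  | add a a' k _ _ ha ha' => rw [add_mul, mul_add, smul_add, ha, ha']
  | mem_mul v hv k a _ ha =>
    obtain ⟨v, rfl⟩ := hv
    rw [mul_assoc, ha, mul_smul_comm, ← mul_assoc, ι_mul_eq_involute_mul_ι,
      mem_paritySubmodule.1 hb, smul_mul_assoc, smul_mul_assoc, mul_assoc, smul_smul, ← pow_add,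
      Nat.succ_mul]

theorem mul_comm_of_mem_exteriorPower_right {k l : ℕ} {a b : ExteriorAlgebra R V}
    (ha : a ∈ paritySubmodule R V k) (hb : b ∈ ⋀[R]^l V) :
    a * b = (-1 : R) ^ (k * l) • (b * a) := by
  rw [mul_comm_of_mem_exteriorPower_left hb ha, smul_smul, mul_comm l, ← pow_add,
    Even.neg_one_pow ⟨_, rfl⟩, one_smul]

theorem dual_ext_of_exteriorPower {f g : Module.Dual R (ExteriorAlgebra R V)}
    (h : ∀ k, ∀ a ∈ ⋀[R]^k V, f a = g a) : f = g :=
  ExteriorAlgebra.lhom_ext fun k => AlternatingMap.ext fun v =>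
    h k _ (ιMulti_range R k ⟨v, rfl⟩)

end ExteriorAlgebra

section InducedNorm

variable {ι E : Type*} [Fintype ι] [AddCommGroup E] [Module ℝ E]

/-- The maximum norm with respect to a basis. It makes the exterior algebra of `ℝⁿ` and its dual
normed spaces, so that multivector-valued functions and forms can be differentiated as such; all
norms being equivalent, the choice of the basis is immaterial. -/
abbrev basisNormedAddCommGroup (b : Module.Basis ι ℝ E) : NormedAddCommGroup E :=
  NormedAddCommGroup.induced E (ι → ℝ) b.equivFun b.equivFun.injective

/-- The normed space structure of `basisNormedAddCommGroup`. -/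
abbrev basisNormedSpace (b : Module.Basis ι ℝ E) :
    @NormedSpace ℝ E _ (basisNormedAddCommGroup b).toSeminormedAddCommGroup :=
  NormedSpace.induced ℝ E (ι → ℝ) b.equivFun

end InducedNorm

section ExteriorAlgebraNorm

variable {n : ℕ}

/-- The norm on `⋀ ℝⁿ` given by the largest component. -/
abbrev extNormedAddCommGroup : NormedAddCommGroup (ExteriorAlgebra ℝ (Model n)) :=
  basisNormedAddCommGroup (extBasis n)

/-- The normed space structure of `extNormedAddCommGroup`. -/
abbrev extNormedSpace : @NormedSpace ℝ (ExteriorAlgebra ℝ (Model n)) _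
    extNormedAddCommGroup.toSeminormedAddCommGroup :=
  basisNormedSpace (extBasis n)

/-- The norm on `(⋀ ℝⁿ)*` given by the largest component. -/
abbrev extDualNormedAddCommGroup :
    NormedAddCommGroup (Module.Dual ℝ (ExteriorAlgebra ℝ (Model n))) :=
  basisNormedAddCommGroup (extBasis n).dualBasis

/-- The normed space structure of `extDualNormedAddCommGroup`. -/
abbrev extDualNormedSpace : @NormedSpace ℝ (Module.Dual ℝ (ExteriorAlgebra ℝ (Model n))) _
    extDualNormedAddCommGroup.toSeminormedAddCommGroup :=
  basisNormedSpace (extBasis n).dualBasis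

instance : FiniteDimensional ℝ (ExteriorAlgebra ℝ (Model n)) :=
  (extBasis n).finiteDimensional_of_finite

end ExteriorAlgebraNorm

section FiniteDimensional

variable {ι E : Type*} [Finite ι] [NormedAddCommGroup E] [NormedSpace ℝ E]
  {F H M : Type*} [NormedAddCommGroup F] [NormedSpace ℝ F] [TopologicalSpace H]
  {I : ModelWithCorners ℝ F H} [TopologicalSpace M] [ChartedSpace H M] {r : WithTop ℕ∞}

theorem contMDiffAt_iff_repr (b : Module.Basis ι ℝ E) {f : M → E} {x : M} :
    ContMDiffAt I 𝓘(ℝ, E) r f x ↔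
      ∀ i, ContMDiffAt I 𝓘(ℝ, ℝ) r (fun p => b.repr (f p) i) x := by
  cases nonempty_fintype ι
  have := b.finiteDimensional_of_finite
  refine Iff.trans ?_ (contMDiffAt_pi_space (φ := fun p => b.equivFunL (f p)))
  refine ⟨fun h => b.equivFunL.contDiff.contMDiff.contMDiffAt.comp x h, fun h => ?_⟩
  have hsymm := b.equivFunL.symm.contDiff.contMDiff.contMDiffAt.comp x h
  exact hsymm.congr_of_eventuallyEq
    (Filter.Eventually.of_forall fun p => (b.equivFunL.symm_apply_apply (f p)).symm)

theorem fderiv_linearMap_comp {G : Type*} [NormedAddCommGroup G] [NormedSpace ℝ G]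
    [FiniteDimensional ℝ E] (L : E →ₗ[ℝ] G) {u : F → E} {y : F} (hu : DifferentiableAt ℝ u y)
    (v : F) : fderiv ℝ (fun z => L (u z)) y v = L (fderiv ℝ u y v) :=
  congrArg (· v) (L.toContinuousLinearMap.hasFDerivAt.comp y hu.hasFDerivAt).fderiv

end FiniteDimensional

section Coordinates

variable {n : ℕ}

attribute [local instance] extNormedAddCommGroup extNormedSpace extDualNormedAddCommGroup
  extDualNormedSpace

theorem extBasis_apply (S : Finset (Fin n)) : extBasis n S =
    ExteriorAlgebra.ιMulti ℝ S.card
      (fun i => EuclideanSpace.single (S.orderEmbOfFin rfl i) (1 : ℝ)) := by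
  rw [extBasis, ExteriorAlgebra.basis_apply_ofCard _ rfl, ExteriorAlgebra.ιMulti_family]
  congr 1
  funext i
  simp
  rfl

theorem extBasis_empty : extBasis n ∅ = 1 :=
  (extBasis_apply ∅).trans (ExteriorAlgebra.ιMulti_zero_apply _)

theorem extBasis_mem (S : Finset (Fin n)) : extBasis n S ∈ ⋀[ℝ]^S.card (Model n) := by
  rw [extBasis_apply]
  exact ExteriorAlgebra.ιMulti_range ℝ _ ⟨_, rfl⟩

theorem extBasis_repr_of_card_ne {k : ℕ} {a : ExteriorAlgebra ℝ (Model n)}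
    (ha : a ∈ ⋀[ℝ]^k (Model n)) {S : Finset (Fin n)} (hS : S.card ≠ k) :
    (extBasis n).repr a S = 0 := by
  rw [extBasis, Module.Basis.ExteriorAlgebra, Module.Basis.repr_reindex_apply,
    Set.powersetCard.prodEquiv_symm_apply]
  exact DirectSum.IsInternal.collectedBasis_repr_of_mem_ne _ _ (Ne.symm hS) ha

variable {w : Model n → Module.Dual ℝ (ExteriorAlgebra ℝ (Model n))}
  {p q u : Model n → ExteriorAlgebra ℝ (Model n)} {y : Model n}

theorem partialDeriv_eq_fderiv (hu : DifferentiableAt ℝ u y) (i : Fin n) :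
    partialDeriv i u y = fderiv ℝ u y (EuclideanSpace.single i 1) := by
  rw [← (extBasis n).sum_repr (fderiv ℝ u y (EuclideanSpace.single i 1)), partialDeriv]
  exact Finset.sum_congr rfl fun S _ =>
    congrArg (· • extBasis n S) (fderiv_linearMap_comp ((extBasis n).coord S) hu _)

theorem partialDeriv_mem_exteriorPower {k : ℕ} (hu : ∀ z, u z ∈ ⋀[ℝ]^k (Model n)) (i : Fin n) :
    partialDeriv i u y ∈ ⋀[ℝ]^k (Model n) := by
  refine Submodule.sum_mem _ fun S _ => ?_
  by_cases hS : S.card = k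
  · exact Submodule.smul_mem _ _ (hS ▸ extBasis_mem S)
  · simp [extBasis_repr_of_card_ne (hu _) hS]

variable (n) in
/-- The interior product `(w, u) ↦ w(u ∧ ·)` on `⋀ ℝⁿ` as a bilinear map. -/
def interiorBilin : Module.Dual ℝ (ExteriorAlgebra ℝ (Model n)) →ₗ[ℝ]
    ExteriorAlgebra ℝ (Model n) →ₗ[ℝ] Module.Dual ℝ (ExteriorAlgebra ℝ (Model n)) :=
  (LinearMap.llcomp ℝ _ _ _).compl₂ (LinearMap.mul ℝ _)

theorem isBoundedBilinearMap_interior : IsBoundedBilinearMap ℝ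
    fun x : Module.Dual ℝ (ExteriorAlgebra ℝ (Model n)) × ExteriorAlgebra ℝ (Model n) =>
      x.1 ∘ₗ LinearMap.mulLeft ℝ x.2 :=
  (LinearMap.toContinuousBilinearMap (interiorBilin n)).isBoundedBilinearMap

theorem differentiableAt_comp_mulLeft (hw : DifferentiableAt ℝ w y)
    (hu : DifferentiableAt ℝ u y) :
    DifferentiableAt ℝ (fun z => w z ∘ₗ LinearMap.mulLeft ℝ (u z)) y :=
  (isBoundedBilinearMap_interior.differentiableAt (w y, u y)).comp y (hw.prodMk hu)

theorem fderiv_comp_mulLeft (hw : DifferentiableAt ℝ w y) (hu : DifferentiableAt ℝ u y)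
    (v : Model n) :
    fderiv ℝ (fun z => w z ∘ₗ LinearMap.mulLeft ℝ (u z)) y v =
      w y ∘ₗ LinearMap.mulLeft ℝ (fderiv ℝ u y v) +
        fderiv ℝ w y v ∘ₗ LinearMap.mulLeft ℝ (u y) := by
  have h := (isBoundedBilinearMap_interior.hasFDerivAt (w y, u y)).comp y
    (hw.hasFDerivAt.prodMk hu.hasFDerivAt)
  exact congrArg (· v) h.fderiv

variable (n) in
/-- The alternating `j`-form underlying a linear functional on `⋀ ℝⁿ`. -/
def alternatingComponent (j : ℕ) :
    Module.Dual ℝ (ExteriorAlgebra ℝ (Model n)) →ₗ[ℝ] Model n [⋀^Fin j]→L[ℝ] ℝ where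
  toFun f := toContinuousAlternating (f.compAlternatingMap (ExteriorAlgebra.ιMulti ℝ j))
  map_add' _ _ := rfl
  map_smul' _ _ := rfl

theorem fderiv_eq_sum_single {E : Type*} [NormedAddCommGroup E] [NormedSpace ℝ E]
    (f : Model n → E) (y v : Model n) :
    fderiv ℝ f y v = ∑ i, v i • fderiv ℝ f y (EuclideanSpace.single i 1) := by
  conv_lhs => rw [← (EuclideanSpace.basisFun (Fin n) ℝ).sum_repr v, map_sum]
  simp

theorem extDerivCoord_apply (hw : DifferentiableAt ℝ w y) (a : ExteriorAlgebra ℝ (Model n)) :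
    extDerivCoord w y a =
      ∑ i, fderiv ℝ w y (EuclideanSpace.single i 1) (contractDx i a) := by
  suffices extDerivCoord w y =
      ∑ i, fderiv ℝ w y (EuclideanSpace.single i 1) ∘ₗ contractDx i by
    rw [this]; simp
  refine ExteriorAlgebra.lhom_ext fun j => AlternatingMap.ext fun v => ?_
  rw [LinearMap.compAlternatingMap_apply, LinearMap.compAlternatingMap_apply, extDerivCoord,
    ExteriorAlgebra.liftAlternating_apply_ιMulti]
  cases j with
  | zero => simp [contractDx, CliffordAlgebra.contractLeft_one]
  | succ j =>
    have hdiff : DifferentiableAt ℝ (fun z => alternatingComponent n j (w z)) y :=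
      (alternatingComponent n j).toContinuousLinearMap.differentiableAt.comp y hw
    change extDeriv (fun z => alternatingComponent n j (w z)) y v = _
    rw [extDeriv_apply hdiff]
    simp only [LinearMap.sum_apply, LinearMap.comp_apply, contractDx, contractLeft_ιMulti,
      map_sum, map_smul]
    rw [Finset.sum_comm]
    refine Finset.sum_congr rfl fun r _ => ?_
    have hcomponent := fderiv_linearMap_comp
      (Module.Dual.eval ℝ _ (ExteriorAlgebra.ιMulti ℝ j (r.removeNth v))) hw (v r)
    refine (congrArg _ hcomponent).trans ?_
    rw [fderiv_eq_sum_single, map_sum, Finset.smul_sum]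
    simp [mul_assoc]

theorem extDerivCoord_congr {w' : Model n → Module.Dual ℝ (ExteriorAlgebra ℝ (Model n))}
    (h : w =ᶠ[nhds y] w') : extDerivCoord w y = extDerivCoord w' y := by
  unfold extDerivCoord
  congr 1
  funext j
  cases j with
  | zero => rfl
  | succ j =>
    exact congrArg ContinuousAlternatingMap.toAlternatingMap
      (h.fun_comp (alternatingComponent n j)).extDeriv_eq

theorem extDerivCoord_comp_mulLeft (hw : DifferentiableAt ℝ w y) (hu : DifferentiableAt ℝ u y)
    (a : ExteriorAlgebra ℝ (Model n)) :
    extDerivCoord (fun z => w z ∘ₗ LinearMap.mulLeft ℝ (u z)) y a =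
      ∑ i, (w y (partialDeriv i u y * contractDx i a) +
        fderiv ℝ w y (EuclideanSpace.single i 1) (u y * contractDx i a)) := by
  rw [extDerivCoord_apply (differentiableAt_comp_mulLeft hw hu)]
  refine Finset.sum_congr rfl fun i _ => ?_
  rw [fderiv_comp_mulLeft hw hu, partialDeriv_eq_fderiv hu]
  rfl

theorem extDerivCoord_mul {k l : ℕ}
    (hw : DifferentiableAt ℝ w y) (hp : DifferentiableAt ℝ p y) (hq : DifferentiableAt ℝ q y)
    (hpk : p y ∈ paritySubmodule ℝ (Model n) k) (hql : ∀ z, q z ∈ ⋀[ℝ]^l (Model n)) :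
    extDerivCoord w y (p y * q y) =
      (-1) ^ ((k + 1) * l) *
          extDerivCoord (fun z => w z ∘ₗ LinearMap.mulLeft ℝ (q z)) y (p y) +
        (-1) ^ k * extDerivCoord (fun z => w z ∘ₗ LinearMap.mulLeft ℝ (p z)) y (q y) +
        (-1) ^ k * w y (schoutenCoord p q y) := by
  rw [extDerivCoord_apply hw, extDerivCoord_comp_mulLeft hw hq, extDerivCoord_comp_mulLeft hw hp,
    schoutenCoord, map_sum, Finset.mul_sum, Finset.mul_sum, Finset.mul_sum,
    ← Finset.sum_add_distrib, ← Finset.sum_add_distrib]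
  refine Finset.sum_congr rfl fun i _ => ?_
  have hξ : contractDx i (p y) ∈ paritySubmodule ℝ (Model n) (k + 1) :=
    contractLeft_mem_paritySubmodule _ hpk
  have hcontract : contractDx i (p y * q y) = contractDx i (p y) * q y +
      (-1 : ℝ) ^ k • (p y * contractDx i (q y)) := by
    rw [contractDx, contractLeft_mul, mem_paritySubmodule.1 hpk, smul_mul_assoc]
  have hsign : (-1 : ℝ) ^ k * (-1) ^ k = 1 := pow_mul_pow_eq_one k (by norm_num)
  rw [hcontract, mul_comm_of_mem_exteriorPower_right hξ (hql y),
    mem_paritySubmodule.1 hξ, smul_mul_assoc,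
    mul_comm_of_mem_exteriorPower_right hξ (partialDeriv_mem_exteriorPower hql i)]
  simp only [map_add, map_sub, map_smul, smul_eq_mul]
  linear_combination (-1) ^ ((k + 1) * l) * w y (partialDeriv i q y * contractDx i (p y)) * hsign

theorem schoutenCoord_mem_paritySubmodule {k l : ℕ}
    (hp : ∀ z, p z ∈ ⋀[ℝ]^k (Model n)) (hq : ∀ z, q z ∈ ⋀[ℝ]^l (Model n)) :
    schoutenCoord p q y ∈ paritySubmodule ℝ (Model n) (k + l + 1) := by
  have hpartial {j : ℕ} {u : Model n → ExteriorAlgebra ℝ (Model n)}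
      (hu : ∀ z, u z ∈ ⋀[ℝ]^j (Model n)) (i : Fin n) :
      partialDeriv i u y ∈ paritySubmodule ℝ (Model n) j :=
    exteriorPower_le_paritySubmodule j (partialDeriv_mem_exteriorPower hu i)
  have hcontract {j : ℕ} {u : Model n → ExteriorAlgebra ℝ (Model n)}
      (hu : ∀ z, u z ∈ ⋀[ℝ]^j (Model n)) (i : Fin n) :
      contractDx i (u y) ∈ paritySubmodule ℝ (Model n) (j + 1) :=
    contractLeft_mem_paritySubmodule _ (exteriorPower_le_paritySubmodule j (hu y))
  refine Submodule.sum_mem _ fun i _ => Submodule.sub_mem _ ?_ ?_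
  · rw [add_right_comm]
    exact mul_mem_paritySubmodule (involute_mem_paritySubmodule (hcontract hp i)) (hpartial hq i)
  · rw [add_assoc]
    exact mul_mem_paritySubmodule (hpartial hp i) (hcontract hq i)

end Coordinates

section Charts

attribute [local instance] extNormedAddCommGroup extNormedSpace extDualNormedAddCommGroup
  extDualNormedSpace

variable {n : ℕ} {M : Type*} [TopologicalSpace M] [ChartedSpace (Model n) M]

theorem differentiableAt_comp_extChartAt_symm {E : Type*} [NormedAddCommGroup E]
    [NormedSpace ℝ E] {f : M → E} {x : M} (hf : ContMDiffAt (𝓡 n) 𝓘(ℝ, E) ∞ f x) :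
    DifferentiableAt ℝ (fun y => f ((extChartAt (𝓡 n) x).symm y)) (extChartAt (𝓡 n) x x) := by
  have h := (contMDiffAt_iff.1 hf).2
  rw [ModelWithCorners.range_eq_univ, contDiffWithinAt_univ] at h
  exact h.differentiableAt (by simp)

variable [IsManifold (𝓡 n) ∞ M]

theorem isSmoothMV_iff {X : MVSection n M} : IsSmoothMV X ↔ ∀ x : M,
    ContMDiffAt (𝓡 n) 𝓘(ℝ, ExteriorAlgebra ℝ (Model n)) ∞ (fun p => toChart x p (X p)) x :=
  forall_congr' fun _ => (contMDiffAt_iff_repr (extBasis n)).symm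

theorem isSmoothForm_iff {w : FormSection n M} : IsSmoothForm w ↔ ∀ x : M,
    ContMDiffAt (𝓡 n) 𝓘(ℝ, Module.Dual ℝ (ExteriorAlgebra ℝ (Model n))) ∞
      (fun p => w p ∘ₗ (fromChart x p).toLinearMap) x := by
  refine forall_congr' fun x => ?_
  simp only [contMDiffAt_iff_repr (extBasis n).dualBasis, Module.Basis.dualBasis_repr]
  rfl

/-- The multivector field `X` in the chart at `x`. -/
def chartMV (x : M) (X : MVSection n M) (y : Model n) : ExteriorAlgebra ℝ (Model n) :=
  toChart x ((extChartAt (𝓡 n) x).symm y) (X ((extChartAt (𝓡 n) x).symm y))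

/-- The form `w` in the chart at `x`. -/
def chartForm (x : M) (w : FormSection n M) (y : Model n) :
    Module.Dual ℝ (ExteriorAlgebra ℝ (Model n)) :=
  w ((extChartAt (𝓡 n) x).symm y) ∘ₗ (fromChart x ((extChartAt (𝓡 n) x).symm y)).toLinearMap

theorem chartMV_extChartAt_self (x : M) (X : MVSection n M) :
    chartMV x X (extChartAt (𝓡 n) x x) = toChart x x (X x) := by
  rw [chartMV, extChartAt_to_inv]

theorem chartForm_extChartAt_self (x : M) (w : FormSection n M)
    (a : ExteriorAlgebra ℝ (Model n)) :
    chartForm x w (extChartAt (𝓡 n) x x) a = w x (fromChart x x a) := by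
  rw [chartForm, extChartAt_to_inv]
  rfl

theorem differentiableAt_chartMV (X : MVField n M) (x : M) :
    DifferentiableAt ℝ (chartMV x X.1) (extChartAt (𝓡 n) x x) :=
  differentiableAt_comp_extChartAt_symm (isSmoothMV_iff.1 X.2 x)

theorem IsSmoothForm.differentiableAt_chartForm {w : FormSection n M} (hw : IsSmoothForm w)
    (x : M) : DifferentiableAt ℝ (chartForm x w) (extChartAt (𝓡 n) x x) :=
  differentiableAt_comp_extChartAt_symm (isSmoothForm_iff.1 hw x)

theorem fromChart_toChart {x p : M} (hp : p ∈ (chartAt (Model n) x).source)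
    (a : ExteriorAlgebra ℝ (TangentSpace (𝓡 n) p)) : fromChart x p (toChart x p a) = a := by
  have h : ((trivializationAt (Model n) (TangentSpace (𝓡 n)) x).symmL ℝ p).toLinearMap ∘ₗ
      ((trivializationAt (Model n) (TangentSpace (𝓡 n)) x).continuousLinearMapAt ℝ p).toLinearMap =
      LinearMap.id :=
    LinearMap.ext fun v => Bundle.Trivialization.symmL_continuousLinearMapAt _ hp v
  rw [fromChart, toChart, ← AlgHom.comp_apply, ExteriorAlgebra.map_comp_map, h,
    ExteriorAlgebra.map_id, AlgHom.id_apply]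

theorem interiorProd_comp_fromChart {x p : M} (hp : p ∈ (chartAt (Model n) x).source)
    (X : MVSection n M) (w : FormSection n M) :
    interiorProd X w p ∘ₗ (fromChart x p).toLinearMap =
      (w p ∘ₗ (fromChart x p).toLinearMap) ∘ₗ LinearMap.mulLeft ℝ (toChart x p (X p)) := by
  refine LinearMap.ext fun a => ?_
  change w p (X p * fromChart x p a) = w p (fromChart x p (toChart x p (X p) * a))
  rw [map_mul (fromChart x p), fromChart_toChart hp]

theorem chartForm_interiorProd (x : M) (X : MVSection n M) (w : FormSection n M) :
    chartForm x (interiorProd X w) =ᶠ[nhds (extChartAt (𝓡 n) x x)]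
      fun y => chartForm x w y ∘ₗ LinearMap.mulLeft ℝ (chartMV x X y) := by
  have hsource : ∀ᶠ y in nhds (extChartAt (𝓡 n) x x),
      (extChartAt (𝓡 n) x).symm y ∈ (chartAt (Model n) x).source := by
    refine (continuousAt_extChartAt_symm (I := 𝓡 n) x).eventually ?_
    rw [extChartAt_to_inv]
    exact chart_source_mem_nhds (Model n) x
  exact hsource.mono fun y hy => interiorProd_comp_fromChart hy X w

theorem IsSmoothForm.interiorProd {w : FormSection n M} (hw : IsSmoothForm w)
    (X : MVField n M) : IsSmoothForm (interiorProd X.1 w) := by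
  refine isSmoothForm_iff.2 fun x => ?_
  have h : ContMDiffAt (𝓡 n) 𝓘(ℝ, Module.Dual ℝ (ExteriorAlgebra ℝ (Model n))) ∞ (fun p =>
      (w p ∘ₗ (fromChart x p).toLinearMap) ∘ₗ LinearMap.mulLeft ℝ (toChart x p (X.1 p))) x :=
    isBoundedBilinearMap_interior.contDiff.contMDiff.contMDiffAt.comp x
      ((isSmoothForm_iff.1 hw x).prodMk_space (isSmoothMV_iff.1 X.2 x))
  refine h.congr_of_eventuallyEq ?_
  filter_upwards [chart_source_mem_nhds (Model n) x] with p hp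
  exact interiorProd_comp_fromChart hp X.1 w

theorem extD_apply {w : FormSection n M} (hw : IsSmoothForm w) (x : M)
    (a : ExteriorAlgebra ℝ (TangentSpace (𝓡 n) x)) :
    extD w x a = ∑ i, fderiv ℝ (chartForm x w) (extChartAt (𝓡 n) x x)
      (EuclideanSpace.single i 1) (contractDx i (toChart x x a)) :=
  extDerivCoord_apply (hw.differentiableAt_chartForm x) _

theorem extD_apply_one (w : FormSection n M) (x : M) : extD w x 1 = 0 := by
  simp [extD, extDerivCoord, ExteriorAlgebra.liftAlternating_one]

theorem extD_apply_algebraMap (w : FormSection n M) (x : M) (r : ℝ) :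
    extD w x (algebraMap ℝ _ r) = 0 := by
  rw [Algebra.algebraMap_eq_smul_one, map_smul, extD_apply_one, smul_zero]

theorem IsSmoothForm.add {w w' : FormSection n M} (hw : IsSmoothForm w) (hw' : IsSmoothForm w') :
    IsSmoothForm (w + w') :=
  fun x S => (hw x S).add (hw' x S)

theorem IsSmoothForm.const_smul {w : FormSection n M} (hw : IsSmoothForm w) (c : ℝ) :
    IsSmoothForm (c • w) :=
  fun x S => contMDiffAt_const.mul (hw x S)

theorem extD_add {w w' : FormSection n M} (hw : IsSmoothForm w) (hw' : IsSmoothForm w') :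
    extD (w + w') = extD w + extD w' := by
  refine funext fun x => LinearMap.ext fun a => ?_
  have hfderiv := fderiv_add (hw.differentiableAt_chartForm x) (hw'.differentiableAt_chartForm x)
  change _ = extD w x a + extD w' x a
  rw [extD_apply hw, extD_apply hw', extD_apply (hw.add hw'), ← Finset.sum_add_distrib]
  exact Finset.sum_congr rfl fun i _ =>
    congrArg (· (EuclideanSpace.single i 1) (contractDx i (toChart x x a))) hfderiv

theorem extD_const_smul {w : FormSection n M} (hw : IsSmoothForm w) (c : ℝ) :
    extD (c • w) = c • extD w := by
  refine funext fun x => LinearMap.ext fun a => ?_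
  have hfderiv := fderiv_const_smul (hw.differentiableAt_chartForm x) c
  change _ = c • extD w x a
  rw [extD_apply hw, extD_apply (hw.const_smul c), Finset.smul_sum]
  exact Finset.sum_congr rfl fun i _ =>
    congrArg (· (EuclideanSpace.single i 1) (contractDx i (toChart x x a))) hfderiv

theorem extD_interiorProd (x : M) (X : MVSection n M) (w : FormSection n M)
    (a : ExteriorAlgebra ℝ (TangentSpace (𝓡 n) x)) :
    extD (interiorProd X w) x a = extDerivCoord
      (fun y => chartForm x w y ∘ₗ LinearMap.mulLeft ℝ (chartMV x X y))
      (extChartAt (𝓡 n) x x) (toChart x x a) := by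
  rw [← extDerivCoord_congr (chartForm_interiorProd x X w)]
  rfl

theorem toChart_mem_exteriorPower {x p : M} {k : ℕ}
    {a : ExteriorAlgebra ℝ (TangentSpace (𝓡 n) p)}
    (ha : a ∈ ⋀[ℝ]^k (TangentSpace (𝓡 n) p)) : toChart x p a ∈ ⋀[ℝ]^k (Model n) :=
  map_mem_exteriorPower _ ha

variable {k l : ℕ} {X Y : MVField n M}

theorem IsDegree.chartMV_mem_exteriorPower (hX : IsDegree k X) (x : M) (y : Model n) :
    chartMV x X.1 y ∈ ⋀[ℝ]^k (Model n) :=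
  map_mem_exteriorPower _ (hX _)

theorem extD_mul (hX : IsDegree k X) (hY : IsDegree l Y) {w : FormSection n M}
    (hw : IsSmoothForm w) (x : M) :
    extD w x (X.1 x * Y.1 x) =
      (-1) ^ ((k + 1) * l) * extD (interiorProd Y.1 w) x (X.1 x) +
        (-1) ^ k * extD (interiorProd X.1 w) x (Y.1 x) +
        (-1) ^ k * w x (schouten X.1 Y.1 x) := by
  have h := extDerivCoord_mul (hw.differentiableAt_chartForm x) (differentiableAt_chartMV X x)
    (differentiableAt_chartMV Y x)
    (exteriorPower_le_paritySubmodule k (hX.chartMV_mem_exteriorPower x _))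
    (hY.chartMV_mem_exteriorPower x)
  rw [chartMV_extChartAt_self, chartMV_extChartAt_self, ← map_mul, chartForm_extChartAt_self,
    ← extD_interiorProd, ← extD_interiorProd] at h
  exact h

theorem schouten_mem_paritySubmodule (hX : IsDegree k X) (hY : IsDegree l Y) (x : M) :
    schouten X.1 Y.1 x ∈ paritySubmodule ℝ (TangentSpace (𝓡 n) x) (k + l + 1) :=
  map_mem_paritySubmodule _ (schoutenCoord_mem_paritySubmodule
    (hX.chartMV_mem_exteriorPower x) (hY.chartMV_mem_exteriorPower x))

end Charts

section Frames

attribute [local instance] extNormedAddCommGroup extNormedSpace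

variable {n : ℕ}

theorem contDiff_exteriorAlgebra_map_apply (a : ExteriorAlgebra ℝ (Model n)) :
    ContDiff ℝ ∞ fun A : Model n →L[ℝ] Model n => ExteriorAlgebra.map A.toLinearMap a := by
  induction a using ExteriorAlgebra.induction with
  | algebraMap r => simpa only [AlgHom.commutes] using contDiff_const
  | ι v =>
    simp only [ExteriorAlgebra.map_apply_ι]
    exact (ExteriorAlgebra.ι ℝ (M := Model n)).toContinuousLinearMap.contDiff.comp
      (contDiff_id.clm_apply contDiff_const)
  | mul a b ha hb =>
    simp only [map_mul]
    exact (LinearMap.toContinuousBilinearMap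
      (LinearMap.mul ℝ (ExteriorAlgebra ℝ (Model n)))).isBoundedBilinearMap.contDiff.comp
        (ha.prodMk hb)
  | add a b ha hb => simpa only [map_add] using ha.add hb

theorem contDiff_exteriorAlgebra_map : ContDiff ℝ ∞ fun A : Model n →L[ℝ] Model n =>
    (ExteriorAlgebra.map A.toLinearMap).toLinearMap.toContinuousLinearMap :=
  contDiff_clm_apply_iff.2 contDiff_exteriorAlgebra_map_apply

variable {M : Type*} [TopologicalSpace M] [ChartedSpace (Model n) M] [IsManifold (𝓡 n) ∞ M]

theorem toChart_fromChart {x y p : M} (hx : p ∈ (chartAt (Model n) x).source)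
    (hy : p ∈ (chartAt (Model n) y).source) (a : ExteriorAlgebra ℝ (Model n)) :
    toChart y p (fromChart x p a) = ExteriorAlgebra.map
      ((trivializationAt (Model n) (TangentSpace (𝓡 n) : M → Type _) x).coordChangeL ℝ
        (trivializationAt (Model n) (TangentSpace (𝓡 n)) y) p :
          Model n →L[ℝ] Model n).toLinearMap a := by
  rw [toChart, fromChart, ← AlgHom.comp_apply, ExteriorAlgebra.map_comp_map]
  congr 2
  refine LinearMap.ext fun v => ?_
  let e := trivializationAt (Model n) (TangentSpace (𝓡 n) : M → Type _) x
  let e' := trivializationAt (Model n) (TangentSpace (𝓡 n) : M → Type _) y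
  change e'.continuousLinearMapAt ℝ p (e.symmL ℝ p v) = e.coordChangeL ℝ e' p v
  rw [Bundle.Trivialization.coordChangeL_apply e e' ⟨hx, hy⟩,
    Bundle.Trivialization.symmL_apply e hx]
  exact congrFun (Bundle.Trivialization.coe_linearMapAt_of_mem e' hy) _

theorem contMDiffAt_toChart_fromChart {x y q : M} (hx : q ∈ (chartAt (Model n) x).source)
    (hy : q ∈ (chartAt (Model n) y).source) {u : M → ExteriorAlgebra ℝ (Model n)}
    (hu : ContMDiffAt (𝓡 n) 𝓘(ℝ, ExteriorAlgebra ℝ (Model n)) ∞ u q) :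
    ContMDiffAt (𝓡 n) 𝓘(ℝ, ExteriorAlgebra ℝ (Model n)) ∞
      (fun p => toChart y p (fromChart x p (u p))) q := by
  have hchange := contMDiffAt_coordChangeL (IB := 𝓡 n) (n := ∞)
    (e := trivializationAt (Model n) (TangentSpace (𝓡 n) : M → Type _) x)
    (e' := trivializationAt (Model n) (TangentSpace (𝓡 n) : M → Type _) y) hx hy
  have hmap := (contDiff_exteriorAlgebra_map (n := n)).contMDiff.contMDiffAt.comp q hchange
  refine (hmap.clm_apply hu).congr_of_eventuallyEq ?_
  filter_upwards [(chartAt (Model n) x).open_source.mem_nhds hx,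
    (chartAt (Model n) y).open_source.mem_nhds hy] with p hpx hpy
  exact toChart_fromChart hpx hpy (u p)

theorem contMDiffAt_toChart (X : MVField n M) {x q : M}
    (hq : q ∈ (chartAt (Model n) x).source) :
    ContMDiffAt (𝓡 n) 𝓘(ℝ, ExteriorAlgebra ℝ (Model n)) ∞ (fun p => toChart x p (X.1 p)) q := by
  refine (contMDiffAt_toChart_fromChart (mem_chart_source _ q) hq
    (isSmoothMV_iff.1 X.2 q)).congr_of_eventuallyEq ?_
  filter_upwards [chart_source_mem_nhds (Model n) q] with p hp
  rw [fromChart_toChart hp]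

theorem ofFun_mul_apply (f : C^∞⟮𝓡 n, M; 𝓘(ℝ, ℝ), ℝ⟯) (X : MVField n M) (p : M) :
    (ofFun f * X).1 p = f p • X.1 p :=
  (Algebra.smul_def (f p) (X.1 p)).symm

theorem toChart_eq_sum_of_mem_exteriorPower {x p : M} {j : ℕ}
    {a : ExteriorAlgebra ℝ (TangentSpace (𝓡 n) p)} (ha : a ∈ ⋀[ℝ]^j (TangentSpace (𝓡 n) p)) :
    toChart x p a =
      ∑ S with S.card = j, (extBasis n).repr (toChart x p a) S • extBasis n S := by
  conv_lhs => rw [← (extBasis n).sum_repr (toChart x p a)]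
  rw [Finset.sum_filter]
  refine Finset.sum_congr rfl fun S _ => ?_
  split_ifs with hS
  · rfl
  · rw [extBasis_repr_of_card_ne (toChart_mem_exteriorPower ha) hS, zero_smul]

variable [T2Space M] {x : M} (ψ : SmoothBumpFunction (𝓡 n) x)

/-- The bump function `ψ` as an element of `C^∞(M)`. -/
def bumpFun : C^∞⟮𝓡 n, M; 𝓘(ℝ, ℝ), ℝ⟯ :=
  ⟨ψ, ψ.contMDiff⟩

/-- The multivector field with the constant components `a` in the chart at `x`, cut off by a bump
function. -/
def cutoffField (a : ExteriorAlgebra ℝ (Model n)) : MVField n M :=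
  ⟨fun p => ψ p • fromChart x p a, by
    refine isSmoothMV_iff.2 fun y => ?_
    by_cases hy : y ∈ tsupport ψ
    · simp only [map_smul]
      exact (ψ.contMDiff.contMDiffAt (x := y)).smul
        (contMDiffAt_toChart_fromChart (ψ.tsupport_subset_chartAt_source hy)
          (mem_chart_source (Model n) y) (contMDiffAt_const (c := a)))
    · refine (contMDiffAt_const (c := 0)).congr_of_eventuallyEq ?_
      filter_upwards [(isClosed_tsupport ψ).isOpen_compl.mem_nhds hy] with p hp
      rw [image_eq_zero_of_notMem_tsupport hp, zero_smul, map_zero]⟩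

theorem cutoffField_apply (a : ExteriorAlgebra ℝ (Model n)) (p : M) :
    (cutoffField ψ a).1 p = ψ p • fromChart x p a :=
  rfl

theorem isDegree_cutoffField {j : ℕ} {a : ExteriorAlgebra ℝ (Model n)}
    (ha : a ∈ ⋀[ℝ]^j (Model n)) : IsDegree j (cutoffField ψ a) :=
  fun _ => Submodule.smul_mem _ _ (map_mem_exteriorPower _ ha)

/-- The components of a multivector field in the chart at `x`, cut off by a bump function. -/
def cutoffCoeff (Y : MVField n M) (S : Finset (Fin n)) : C^∞⟮𝓡 n, M; 𝓘(ℝ, ℝ), ℝ⟯ :=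
  ⟨fun p => ψ p • (extBasis n).repr (toChart x p (Y.1 p)) S,
    ψ.contMDiff_smul fun _ hq => ((contMDiffAt_iff_repr (extBasis n)).1
      (contMDiffAt_toChart Y hq) S).contMDiffWithinAt⟩

theorem cutoffCoeff_apply (Y : MVField n M) (S : Finset (Fin n)) (p : M) :
    cutoffCoeff ψ Y S p = ψ p * (extBasis n).repr (toChart x p (Y.1 p)) S :=
  rfl

theorem exists_isDegree_apply_eq (x : M) {j : ℕ} {a : ExteriorAlgebra ℝ (TangentSpace (𝓡 n) x)}
    (ha : a ∈ ⋀[ℝ]^j (TangentSpace (𝓡 n) x)) : ∃ Y : MVField n M, IsDegree j Y ∧ Y.1 x = a := by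
  let ψ : SmoothBumpFunction (𝓡 n) x := Classical.arbitrary _
  refine ⟨cutoffField ψ (toChart x x a), isDegree_cutoffField ψ (toChart_mem_exteriorPower ha), ?_⟩
  rw [cutoffField_apply, ψ.eq_one, one_smul, fromChart_toChart (mem_chart_source _ x)]

-- One factor `ψ` extends the components of `Y` to `M`, the other one the frame `e_S`.
theorem bumpFun_mul_eq_sum {j : ℕ} {Y : MVField n M} (hY : IsDegree j Y) :
    ofFun (bumpFun ψ) * (ofFun (bumpFun ψ) * Y) =
      ∑ S with S.card = j, ofFun (cutoffCoeff ψ Y S) * cutoffField ψ (extBasis n S) := by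
  refine Subtype.ext (funext fun p => ?_)
  rw [ofFun_mul_apply, ofFun_mul_apply, AddSubmonoidClass.coe_finsetSum, Finset.sum_apply]
  simp_rw [ofFun_mul_apply, cutoffField_apply, cutoffCoeff_apply]
  change ψ p • ψ p • Y.1 p = _
  by_cases hp : p ∈ (chartAt (Model n) x).source
  · conv_lhs => rw [← fromChart_toChart hp (Y.1 p), toChart_eq_sum_of_mem_exteriorPower (hY p)]
    simp only [map_sum, map_smul, Finset.smul_sum, smul_smul]
    exact Finset.sum_congr rfl fun S _ => by congr 1; ring
  · have hψ : ψ p = 0 :=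
      image_eq_zero_of_notMem_tsupport fun h => hp (ψ.tsupport_subset_chartAt_source h)
    simp [hψ]

theorem exists_dual_of_homogeneous (x : M) {j : ℕ} (F : MVField n M →+ ℝ)
    (hF : ∀ (f : C^∞⟮𝓡 n, M; 𝓘(ℝ, ℝ), ℝ⟯) (Y : MVField n M), IsDegree j Y →
      F (ofFun f * Y) = f x * F Y) :
    ∃ g : Module.Dual ℝ (ExteriorAlgebra ℝ (TangentSpace (𝓡 n) x)),
      (∀ i ≠ j, ∀ a ∈ ⋀[ℝ]^i (TangentSpace (𝓡 n) x), g a = 0) ∧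
        ∀ Y : MVField n M, IsDegree j Y → g (Y.1 x) = F Y := by
  let ψ : SmoothBumpFunction (𝓡 n) x := Classical.arbitrary _
  refine ⟨(∑ S with S.card = j, F (cutoffField ψ (extBasis n S)) • (extBasis n).coord S) ∘ₗ
    (toChart x x).toLinearMap, fun i hi a ha => ?_, fun Y hY => ?_⟩
  · simp only [LinearMap.comp_apply, LinearMap.sum_apply, LinearMap.smul_apply,
      Module.Basis.coord_apply, AlgHom.toLinearMap_apply]
    refine Finset.sum_eq_zero fun S hS => ?_
    have hcard : S.card ≠ i := by rintro rfl; exact hi (Finset.mem_filter.1 hS).2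
    rw [extBasis_repr_of_card_ne (toChart_mem_exteriorPower ha) hcard, smul_zero]
  · have hψY : IsDegree j (ofFun (bumpFun ψ) * Y) := fun p => by
      rw [ofFun_mul_apply]
      exact Submodule.smul_mem _ _ (hY p)
    have hψ : bumpFun ψ x = 1 := ψ.eq_one
    have h := congrArg F (bumpFun_mul_eq_sum ψ hY)
    rw [hF _ _ hψY, hF _ _ hY, hψ, one_mul, one_mul, map_sum] at h
    simp only [h, LinearMap.comp_apply, LinearMap.sum_apply, LinearMap.smul_apply,
      Module.Basis.coord_apply, AlgHom.toLinearMap_apply]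
    refine Finset.sum_congr rfl fun S hS => ?_
    rw [hF _ _ ((Finset.mem_filter.1 hS).2 ▸ isDegree_cutoffField ψ (extBasis_mem S)),
      cutoffCoeff_apply, ψ.eq_one, one_mul, smul_eq_mul, mul_comm]

end Frames

section Signs

theorem neg_one_zpow_sub_one (k : ℕ) : (-1 : ℝ) ^ ((k : ℤ) - 1) = (-1) ^ (k + 1) := by
  rw [zpow_sub_one₀ (by norm_num), zpow_natCast, pow_succ, inv_neg, inv_one]

theorem neg_one_zpow_sub_one_mul (k l : ℕ) :
    (-1 : ℝ) ^ (((k : ℤ) - 1) * (l : ℤ)) = (-1) ^ ((k + 1) * l) := by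
  rw [zpow_mul, neg_one_zpow_sub_one, zpow_natCast, pow_mul]

theorem neg_one_zpow_mul_sub_one (k l : ℕ) :
    (-1 : ℝ) ^ ((k : ℤ) * ((l : ℤ) - 1)) = (-1) ^ (k * (l + 1)) := by
  rw [mul_comm, neg_one_zpow_sub_one_mul, mul_comm]

theorem neg_one_zpow_sub_one_mul_sub_one (k l : ℕ) :
    (-1 : ℝ) ^ (((k : ℤ) - 1) * ((l : ℤ) - 1)) = (-1) ^ ((k + 1) * (l + 1)) := by
  rw [zpow_mul, neg_one_zpow_sub_one, ← zpow_natCast, ← zpow_mul, neg_one_zpow_mul_sub_one]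

end Signs

section CovariantDerivative

variable {n : ℕ} {M : Type*} [TopologicalSpace M] [ChartedSpace (Model n) M]

theorem interiorProd_mul (X Y : MVSection n M) (w : FormSection n M) :
    interiorProd (X * Y) w = interiorProd Y (interiorProd X w) := by
  refine funext fun x => LinearMap.ext fun a => ?_
  exact congrArg (w x) (mul_assoc _ _ _)

theorem interiorProd_add (X Y : MVSection n M) (w : FormSection n M) :
    interiorProd (X + Y) w = interiorProd X w + interiorProd Y w := by
  refine funext fun x => LinearMap.ext fun a => ?_
  exact (congrArg (w x) (add_mul _ _ _)).trans (map_add _ _ _)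

variable [IsManifold (𝓡 n) ∞ M]

theorem IsDegree.mul {k l : ℕ} {X Y : MVField n M} (hX : IsDegree k X) (hY : IsDegree l Y) :
    IsDegree (k + l) (X * Y) :=
  fun x => SetLike.mul_mem_graded (hX x) (hY x)

theorem isDegree_ofFun (f : C^∞⟮𝓡 n, M; 𝓘(ℝ, ℝ), ℝ⟯) : IsDegree 0 (ofFun f : MVField n M) :=
  fun _ => SetLike.algebraMap_mem_graded _ _

theorem IsDegree.exists_eq_ofFun {X : MVField n M} (hX : IsDegree 0 X) :
    ∃ f : C^∞⟮𝓡 n, M; 𝓘(ℝ, ℝ), ℝ⟯, X = ofFun f := by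
  have hX' : ∀ x, ∃ r : ℝ, algebraMap ℝ _ r = X.1 x := fun x => by
    simpa only [ExteriorAlgebra.exteriorPower, pow_zero, Submodule.mem_one] using hX x
  choose f hf using hX'
  have hone : (extBasis n).repr 1 ∅ = 1 := by
    rw [← extBasis_empty, Module.Basis.repr_self, Finsupp.single_eq_same]
  refine ⟨⟨f, fun x => (X.2 x ∅).congr_of_eventuallyEq (.of_forall fun p => ?_)⟩,
    Subtype.ext (funext fun x => (hf x).symm)⟩
  change f p = (extBasis n).repr (toChart x p (X.1 p)) ∅
  rw [← hf, AlgHom.commutes, Algebra.algebraMap_eq_smul_one, map_smul, Finsupp.smul_apply, hone,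
    smul_eq_mul, mul_one]

theorem interiorProd_interiorProd {k l : ℕ} {X Y : MVField n M} (hX : IsDegree k X)
    (hY : IsDegree l Y) (w : FormSection n M) :
    interiorProd X.1 (interiorProd Y.1 w) =
      (-1 : ℝ) ^ (k * l) • interiorProd (X * Y).1 w := by
  refine funext fun x => LinearMap.ext fun a => ?_
  change w x (Y.1 x * (X.1 x * a)) = (-1 : ℝ) ^ (k * l) • w x (X.1 x * Y.1 x * a)
  rw [← mul_assoc, mul_comm_of_mem_exteriorPower_left (hY x)
    (exteriorPower_le_paritySubmodule k (hX x)), smul_mul_assoc, map_smul, mul_comm l]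

theorem extD_interiorProd_ofFun {k : ℕ} {X : MVField n M} (hX : IsDegree k X)
    {w : FormSection n M} (hw : IsSmoothForm w) (f : C^∞⟮𝓡 n, M; 𝓘(ℝ, ℝ), ℝ⟯) (x : M) :
    extD (interiorProd (ofFun f).1 w) x (X.1 x) =
      f x * extD w x (X.1 x) - (-1) ^ k * w x (schouten X.1 (ofFun f).1 x) := by
  have h := extD_mul hX (isDegree_ofFun f) hw x
  have hf : extD (interiorProd X.1 w) x ((ofFun f).1 x) = 0 := extD_apply_algebraMap _ _ _
  have hmul : X.1 x * (ofFun f).1 x = f x • X.1 x :=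
    (Algebra.commutes _ _).symm.trans (Algebra.smul_def _ _).symm
  rw [hf, hmul, map_smul, smul_eq_mul] at h
  linear_combination -h

theorem lieDeriv_apply_one (k : ℕ) (X : MVSection n M) (w : FormSection n M) (x : M) :
    lieDeriv k X w x 1 = (-1) ^ (k + 1) * extD w x (X x) := by
  have h : lieDeriv k X w x 1 = extD (interiorProd X w) x 1 - (-1) ^ k * extD w x (X x * 1) := rfl
  rw [h, extD_apply_one, mul_one]
  ring

namespace HigherConnection

variable {D : HigherConnection n M} {k l m j : ℕ} {X Y Z : MVField n M} {w : FormSection n M}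

variable (D) in
/-- The function `Y ↦ (-1)^((k-1)(m-1)) L_X i_Y w - w(∇_X Y)` at the point `x`, for `X` of degree
`k` and an `m`-form `w`: what the covariant derivative `∇_X w` is required to be on fields `Y` of
degree `m - k + 1`. The Lie derivative is expanded with `lieDeriv_apply_one`. -/
def covEval (k m : ℕ) (X : MVField n M) (hw : IsSmoothForm w) (x : M) : MVField n M →+ ℝ :=
  AddMonoidHom.mk' (fun Y => (-1) ^ ((k + 1) * m) * extD (interiorProd Y.1 w) x (X.1 x) -
    w x ((D.cov X Y).1 x)) fun Y Y' => by
      have hcov : (D.cov X (Y + Y')).1 x = (D.cov X Y).1 x + (D.cov X Y').1 x := by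
        rw [D.right_add]
        rfl
      have hextD : extD (interiorProd (Y + Y').1 w) x (X.1 x) =
          extD (interiorProd Y.1 w) x (X.1 x) + extD (interiorProd Y'.1 w) x (X.1 x) := by
        rw [Subalgebra.coe_add, interiorProd_add, extD_add (hw.interiorProd Y) (hw.interiorProd Y')]
        rfl
      rw [hcov, hextD, map_add]
      ring

theorem covEval_apply (hw : IsSmoothForm w) (x : M) :
    D.covEval k m X hw x Y =
      (-1) ^ ((k + 1) * m) * extD (interiorProd Y.1 w) x (X.1 x) - w x ((D.cov X Y).1 x) :=
  rfl

theorem covEval_eq_lieDeriv (hw : IsSmoothForm w) (x : M) :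
    D.covEval k m X hw x Y = (-1 : ℝ) ^ (((k : ℤ) - 1) * ((m : ℤ) - 1)) *
      lieDeriv k X.1 (interiorProd Y.1 w) x 1 - w x ((D.cov X Y).1 x) := by
  have hsign : (-1 : ℝ) ^ ((k + 1) * m) = (-1) ^ ((k + 1) * (m + 1)) * (-1) ^ (k + 1) := by
    rw [← pow_add]
    exact neg_one_pow_congr (by grind)
  rw [neg_one_zpow_sub_one_mul_sub_one, lieDeriv_apply_one, covEval_apply, hsign, mul_assoc]

theorem covEval_ofFun_left (hw : IsSmoothForm w) (x : M) (f : C^∞⟮𝓡 n, M; 𝓘(ℝ, ℝ), ℝ⟯) :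
    D.covEval 0 m (ofFun f) hw x Y = 0 := by
  have hextD : extD (interiorProd Y.1 w) x ((ofFun f).1 x) = 0 := extD_apply_algebraMap _ _ _
  rw [covEval_apply, hextD, D.cov_fun, mul_zero, zero_sub, neg_eq_zero]
  exact map_zero _

theorem covEval_ofFun_mul (hX : IsDegree k X) (hY : IsDegree j Y) (hw : IsSmoothForm w)
    (hj : j + k = m + 1) (x : M) (f : C^∞⟮𝓡 n, M; 𝓘(ℝ, ℝ), ℝ⟯) :
    D.covEval k m X hw x (ofFun f * Y) = f x * D.covEval k m X hw x Y := by
  have hcov : (D.cov X (ofFun f * Y)).1 x =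
      (-1 : ℝ) ^ ((k + 1) * j) • (Y.1 x * schouten X.1 (ofFun f).1 x) + f x • (D.cov X Y).1 x := by
    rw [D.leibniz k X f Y hX, ← mul_comm_of_mem_exteriorPower_right
      (schouten_mem_paritySubmodule hX (isDegree_ofFun f) x) (hY x), ← ofFun_mul_apply]
    rfl
  have hextD : extD (interiorProd (ofFun f * Y).1 w) x (X.1 x) =
      f x * extD (interiorProd Y.1 w) x (X.1 x) -
        (-1) ^ k * w x (Y.1 x * schouten X.1 (ofFun f).1 x) := by
    have h := extD_interiorProd_ofFun hX (hw.interiorProd Y) f x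
    rwa [interiorProd_interiorProd (isDegree_ofFun f) hY, zero_mul, pow_zero, one_smul] at h
  have hsign : (-1 : ℝ) ^ ((k + 1) * m) * (-1) ^ k = -(-1) ^ ((k + 1) * j) := by
    rw [← pow_add, ← neg_one_mul (_ ^ ((k + 1) * j)), ← pow_succ']
    exact neg_one_pow_congr (by clear * - hj; grind)
  rw [covEval_apply, covEval_apply, hcov, hextD, map_add, map_smul, map_smul, smul_eq_mul,
    smul_eq_mul]
  linear_combination -(w x (Y.1 x * schouten X.1 (ofFun f).1 x)) * hsign

theorem exists_isCovDeriv [T2Space M] (hX : IsDegree k X) (hw : IsSmoothForm w) :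
    ∃ h, D.IsCovDeriv k m X w h := by
  by_cases hkm : 0 < k ∧ k ≤ m + 1
  · choose h hdegree happly using fun x => exists_dual_of_homogeneous x (D.covEval k m X hw x)
      fun f Y hY => covEval_ofFun_mul (j := m + 1 - k) hX hY hw (by omega) x f
    refine ⟨h, fun x i hi => hdegree x i (by omega), fun _ i Y hi hY x => ?_, by omega⟩
    obtain rfl : i = m + 1 - k := by omega
    rw [happly x Y hY, covEval_eq_lieDeriv]
  · exact ⟨0, fun _ _ _ _ _ => rfl, fun _ _ _ _ => by omega, fun _ => rfl⟩

theorem isCovDeriv_covForm [T2Space M] (hX : IsDegree k X) (hw : IsSmoothForm w) :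
    D.IsCovDeriv k m X w (D.covForm k m X w) := by
  have h : ∃ h, D.IsCovDeriv k m X w h := exists_isCovDeriv hX hw
  rw [covForm, dif_pos h]
  exact h.choose_spec

theorem covForm_apply [T2Space M] (hX : IsDegree k X) (hY : IsDegree j Y) (hw : IsSmoothForm w)
    (hj : j + k = m + 1) (x : M) :
    D.covForm k m X w x (Y.1 x) = D.covEval k m X hw x Y := by
  have h : D.IsCovDeriv k m X w (D.covForm k m X w) := isCovDeriv_covForm hX hw
  rcases k.eq_zero_or_pos with rfl | hk
  · obtain ⟨f, rfl⟩ := hX.exists_eq_ofFun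
    rw [h.zero rfl, covEval_ofFun_left]
    rfl
  · rw [h.apply hk j Y hj hY x, covEval_eq_lieDeriv]

theorem cov_mul_apply (hind : D.IsInduced) (htor : D.IsTorsionFree) (hX : IsDegree k X)
    (hY : IsDegree l Y) (x : M) :
    (D.cov (X * Y) Z).1 x = (-1 : ℝ) ^ l • (D.cov X (Y * Z)).1 x +
      (-1 : ℝ) ^ (k * (l + 1)) • (D.cov Y (X * Z)).1 x -
        (-1 : ℝ) ^ l • (schouten X.1 Y.1 x * Z.1 x) := by
  have hlower : (D.cov (X * Y) Z).1 x =
      X.1 x * (D.cov Y Z).1 x + (-1 : ℝ) ^ (k * l) • (Y.1 x * (D.cov X Z).1 x) := by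
    rw [hind.lower k l X Y Z hX hY]
    rfl
  have hupper_left : (D.cov X (Y * Z)).1 x = (D.cov X Y).1 x * Z.1 x +
      (-1 : ℝ) ^ ((k + 1) * l) • (Y.1 x * (D.cov X Z).1 x) := by
    rw [hind.upper k l X Y Z hX hY, neg_one_zpow_sub_one_mul]
    rfl
  have hupper_right : (D.cov Y (X * Z)).1 x = (D.cov Y X).1 x * Z.1 x +
      (-1 : ℝ) ^ ((l + 1) * k) • (X.1 x * (D.cov Y Z).1 x) := by
    rw [hind.upper l k Y X Z hY hX, neg_one_zpow_sub_one_mul]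
    rfl
  have hschouten : schouten X.1 Y.1 x =
      (D.cov X Y).1 x - (-1 : ℝ) ^ ((k + 1) * (l + 1)) • (D.cov Y X).1 x := by
    rw [← neg_one_zpow_sub_one_mul_sub_one]
    exact (sub_eq_zero.1 (congrFun (htor k l X Y hX hY) x)).symm
  have hXZ : (-1 : ℝ) ^ l * (-1) ^ ((k + 1) * l) = (-1) ^ (k * l) := by
    rw [← pow_add]
    exact neg_one_pow_congr (by clear * -; grind)
  have hYZ : (-1 : ℝ) ^ (k * (l + 1)) * (-1) ^ ((l + 1) * k) = 1 := by
    rw [← pow_add]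
    exact Even.neg_one_pow (by clear * -; grind)
  have hYX : (-1 : ℝ) ^ l * (-1) ^ ((k + 1) * (l + 1)) = -(-1) ^ (k * (l + 1)) := by
    rw [← pow_add, ← neg_one_mul (_ ^ (k * (l + 1))), ← pow_succ']
    exact neg_one_pow_congr (by clear * -; grind)
  rw [hlower, hupper_left, hupper_right, hschouten, sub_mul, smul_mul_assoc]
  simp only [smul_add, smul_sub, smul_smul, hXZ, hYZ, hYX, neg_smul, one_smul]
  abel

theorem extD_interiorProd_mul (hX : IsDegree k X) (hY : IsDegree l Y) (hZ : IsDegree j Z)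
    (hw : IsSmoothForm w) (hj : j + (k + l) = m + 1) (x : M) :
    (-1) ^ ((k + l + 1) * m) * extD (interiorProd Z.1 w) x ((X * Y).1 x) =
      (-1) ^ l * ((-1) ^ ((k + 1) * m) * extD (interiorProd (Y * Z).1 w) x (X.1 x)) +
        (-1) ^ (k * (l + 1)) *
          ((-1) ^ ((l + 1) * m) * extD (interiorProd (X * Z).1 w) x (Y.1 x)) -
        (-1) ^ l * w x (schouten X.1 Y.1 x * Z.1 x) := by
  have hmul : extD (interiorProd Z.1 w) x ((X * Y).1 x) = _ :=
    extD_mul hX hY (hw.interiorProd Z) x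
  have hschouten : interiorProd Z.1 w x (schouten X.1 Y.1 x) =
      (-1) ^ ((k + l + 1) * j) * w x (schouten X.1 Y.1 x * Z.1 x) := by
    rw [mul_comm_of_mem_exteriorPower_right (schouten_mem_paritySubmodule hX hY x) (hZ x),
      map_smul, smul_eq_mul, ← mul_assoc, ← pow_add, Even.neg_one_pow ⟨_, rfl⟩, one_mul]
    rfl
  rw [hschouten, interiorProd_interiorProd hY hZ, interiorProd_interiorProd hX hZ,
    extD_const_smul (hw.interiorProd _), extD_const_smul (hw.interiorProd _)] at hmul
  simp only [Pi.smul_apply, LinearMap.smul_apply, smul_eq_mul] at hmul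
  have hYZ : (-1 : ℝ) ^ ((k + l + 1) * m) * (-1) ^ ((k + 1) * l) * (-1) ^ (l * j) =
      (-1) ^ l * (-1) ^ ((k + 1) * m) := by
    simp only [← pow_add]
    exact neg_one_pow_congr (by clear * - hj; grind)
  have hXZ : (-1 : ℝ) ^ ((k + l + 1) * m) * (-1) ^ k * (-1) ^ (k * j) =
      (-1) ^ (k * (l + 1)) * (-1) ^ ((l + 1) * m) := by
    simp only [← pow_add]
    exact neg_one_pow_congr (by clear * - hj; grind)
  have hXY : (-1 : ℝ) ^ ((k + l + 1) * m) * (-1) ^ k * (-1) ^ ((k + l + 1) * j) =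
      -(-1) ^ l := by
    rw [← neg_one_mul (_ ^ l)]
    simp only [← pow_succ', ← pow_add]
    exact neg_one_pow_congr (by clear * - hj; grind)
  rw [hmul]
  linear_combination hYZ * extD (interiorProd (Y * Z).1 w) x (X.1 x) +
    hXZ * extD (interiorProd (X * Z).1 w) x (Y.1 x) +
    hXY * w x (schouten X.1 Y.1 x * Z.1 x)

theorem covEval_mul (hind : D.IsInduced) (htor : D.IsTorsionFree) (hX : IsDegree k X)
    (hY : IsDegree l Y) (hZ : IsDegree j Z) (hw : IsSmoothForm w) (hj : j + (k + l) = m + 1)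
    (x : M) :
    D.covEval (k + l) m (X * Y) hw x Z =
      (-1) ^ l * D.covEval k m X hw x (Y * Z) +
        (-1) ^ (k * (l + 1)) * D.covEval l m Y hw x (X * Z) := by
  simp only [covEval_apply]
  rw [extD_interiorProd_mul hX hY hZ hw hj, cov_mul_apply hind htor hX hY]
  simp only [map_add, map_sub, map_smul, smul_eq_mul]
  ring

theorem covForm_mul [T2Space M] (hind : D.IsInduced) (htor : D.IsTorsionFree) (hX : IsDegree k X)
    (hY : IsDegree l Y) (hw : IsSmoothForm w) :
    D.covForm (k + l) m (X * Y) w =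
      (-1 : ℝ) ^ l • interiorProd Y.1 (D.covForm k m X w) +
        (-1 : ℝ) ^ ((k : ℤ) * ((l : ℤ) - 1)) • interiorProd X.1 (D.covForm l m Y w) := by
  refine funext fun x => dual_ext_of_exteriorPower fun j a ha => ?_
  obtain ⟨Z, hZ, rfl⟩ := exists_isDegree_apply_eq x ha
  change D.covForm (k + l) m (X * Y) w x (Z.1 x) =
    (-1) ^ l * D.covForm k m X w x ((Y * Z).1 x) +
      (-1) ^ ((k : ℤ) * ((l : ℤ) - 1)) * D.covForm l m Y w x ((X * Z).1 x)
  by_cases hj : j + (k + l) = m + 1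
  · rw [covForm_apply (hX.mul hY) hZ hw hj, covForm_apply hX (hY.mul hZ) hw (by omega),
      covForm_apply hY (hX.mul hZ) hw (by omega), neg_one_zpow_mul_sub_one,
      covEval_mul hind htor hX hY hZ hw hj]
  · rw [(isCovDeriv_covForm (hX.mul hY) hw).degree x j hj _ ha,
      (isCovDeriv_covForm hX hw).degree x (l + j) (by omega) _ (hY.mul hZ x),
      (isCovDeriv_covForm hY hw).degree x (k + j) (by omega) _ (hX.mul hZ x)]
    simp

end HigherConnection

end CovariantDerivative

end HigherConn

end

theorem mainTheorem8 (n : ℕ) (M : Type*) [TopologicalSpace M] [T2Space M]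
    [ChartedSpace (Model n) M] [IsManifold (𝓡 n) ∞ M]
    (D : HigherConnection n M) (hind : D.IsInduced) (htor : D.IsTorsionFree)
    (m : ℕ) (w : FormSection n M) (hw : IsForm m w) :
    (∀ (k : ℕ) (X : MVField n M), IsDegree k X → D.IsCovDeriv k m X w (D.covForm k m X w)) ∧
    ∀ (k l : ℕ) (X Y : MVField n M), IsDegree k X → IsDegree l Y →
      D.covForm (k + l) m (X * Y) w =
        (-1 : ℝ) ^ l • interiorProd Y.1 (D.covForm k m X w) +
        (-1 : ℝ) ^ ((k : ℤ) * ((l : ℤ) - 1)) • interiorProd X.1 (D.covForm l m Y w) := by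
  exact ⟨fun _ _ hX => HigherConnection.isCovDeriv_covForm hX hw.smooth,
    fun _ _ _ _ hX hY =>
      HigherConnection.covForm_mul hind htor hX hY hw.smooth⟩
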